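/- For a prime $p$ and an integer $n\ge 1$, let $H_n$ and $M_n$ be the extra special groups of order $p^{2n+1}$ whose elements are the triples $[x,y,z]$ with $x,y\in\mathbb F_p^n$ and $z\in\mathbb F_p$, with multiplication in $H_n$ given by $$[x,y,z]\cdot[x',y',z']=[x+x',\,y+y',\,z+z'+\langle x,y'\rangle]$$ and in $M_n$ given by $$[x,y,z]\cdot[x',y',z']=[x+x',\,y+y',\,z+z'+\langle x,y'\rangle+f(y,y')],$$ where $\langle x,y'\rangle=\sum_{i=1}^n x_iy'_i$ and $f(y,y')=\sum_{i=1}^n\left\lfloor\frac{(y_i \bmod p)+(y'_i \bmod p)}{p}\right\rfloor$, residues being taken in $\{0,\dots,p-1\}$. For $G\in\{H_n,M_n\}$, a brick in $G$ is a subset of the form $$B=\{[x,y,z]: x\in X_1\times\dots\times X_n,\ y\in Y_1\times\dots\times Y_n,\ z\in Z\}$$ with non-empty sets $X_i,Y_i,Z\subseteq\mathbb F_p$. Theorem. For every $\varepsilon>0$ there exists a positive integer $n_0=n_0(\varepsilon)$ such that for every $n\ge n_0$, every prime $p$, every $G\in\{H_n,M_n\}$ and every brick $B\subseteq G$ with $$|B|>|G|^{3/4+\varepsilon},$$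 the center of $G$ is a non-trivial subgroup of $G$, and the product set $B\cdot B=\{bb' : b,b'\in B\}$ contains at least $|B|/p$ cosets of the center of $G$. -/

import Mathlib

open scoped Pointwise

/-- Elements of the extra special group `H_n` of order `p ^ (2 * n + 1)` (the Heisenberg group):
triples `[x, y, z]` with `x, y ∈ 𝔽_p ^ n` and `z ∈ 𝔽_p`, standing for the unitriangular matrices
with first row `(1, x, z)`, middle block `I_n` and last column `(z, y, 1)`. -/
@[ext]
structure HeisGroup (n p : ℕ) where
  x : Fin n → ZMod p
  y : Fin n → ZMod p
  z : ZMod p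

/-- Elements of the extra special group `M_n` of order `p ^ (2 * n + 1)`:
triples `[x, y, z]` with `x, y ∈ 𝔽_p ^ n` and `z ∈ 𝔽_p`. -/
@[ext]
structure ModGroup (n p : ℕ) where
  x : Fin n → ZMod p
  y : Fin n → ZMod p
  z : ZMod p

namespace HeisGroup

variable {n p : ℕ}

/-- The product `[x, y, z] [x', y', z'] = [x + x', y + y', z + z' + ⟨x, y'⟩]`. -/
instance : Mul (HeisGroup n p) :=
  ⟨fun g h => ⟨g.x + h.x, g.y + h.y, g.z + h.z + ∑ i, g.x i * h.y i⟩⟩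

instance : One (HeisGroup n p) := ⟨⟨0, 0, 0⟩⟩

instance : Inv (HeisGroup n p) := ⟨fun g => ⟨-g.x, -g.y, -g.z + ∑ i, g.x i * g.y i⟩⟩

@[simp] theorem mul_x (g h : HeisGroup n p) : (g * h).x = g.x + h.x := rfl
@[simp] theorem mul_y (g h : HeisGroup n p) : (g * h).y = g.y + h.y := rfl
@[simp] theorem mul_z (g h : HeisGroup n p) :
    (g * h).z = g.z + h.z + ∑ i, g.x i * h.y i := rfl
@[simp] theorem one_x : (1 : HeisGroup n p).x = 0 := rfl
@[simp] theorem one_y : (1 : HeisGroup n p).y = 0 := rfl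
@[simp] theorem one_z : (1 : HeisGroup n p).z = 0 := rfl
@[simp] theorem inv_x (g : HeisGroup n p) : g⁻¹.x = -g.x := rfl
@[simp] theorem inv_y (g : HeisGroup n p) : g⁻¹.y = -g.y := rfl
@[simp] theorem inv_z (g : HeisGroup n p) : g⁻¹.z = -g.z + ∑ i, g.x i * g.y i := rfl

instance : Group (HeisGroup n p) :=
  Group.ofLeftAxioms
    (by
      intro a b c
      ext i
      · simp [add_assoc]
      · simp [add_assoc]
      · simp only [mul_x, mul_y, mul_z, Pi.add_apply, add_mul, mul_add, Finset.sum_add_distrib]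
        ring)
    (by intro a; ext i <;> simp)
    (by intro a; ext i <;> simp)

/-- A brick of `H_n`: all `[x, y, z]` with `x ∈ X_1 × ⋯ × X_n`, `y ∈ Y_1 × ⋯ × Y_n`, `z ∈ Z`,
for nonempty `X_i, Y_i, Z ⊆ 𝔽_p`. -/
def IsBrick (B : Set (HeisGroup n p)) : Prop :=
  ∃ (X Y : Fin n → Set (ZMod p)) (Z : Set (ZMod p)),
    (∀ i, (X i).Nonempty) ∧ (∀ i, (Y i).Nonempty) ∧ Z.Nonempty ∧
    B = {g | (∀ i, g.x i ∈ X i) ∧ (∀ i, g.y i ∈ Y i) ∧ g.z ∈ Z}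

end HeisGroup

namespace ModGroup

variable {n p : ℕ}

/-- The number `∑ i, ⌊(y_i mod p + y'_i mod p) / p⌋` of coordinates in which the addition of the
residues in `{0, …, p - 1}` produces a carry. -/
def carry (y y' : Fin n → ZMod p) : ℕ := ∑ i, ((y i).val + (y' i).val) / p

theorem carry_assoc [NeZero p] (a b c : Fin n → ZMod p) :
    carry (a + b) c + carry a b = carry a (b + c) + carry b c := by
  unfold carry
  rw [← Finset.sum_add_distrib, ← Finset.sum_add_distrib]
  refine Finset.sum_congr rfl fun i _ => ?_
  have hp : 0 < p := Nat.pos_of_ne_zero (NeZero.ne p)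
  have key : ∀ m k : ℕ, (m % p + k) / p + m / p = (m + k) / p := by
    intro m k
    conv_rhs => rw [← Nat.mod_add_div m p]
    rw [show m % p + p * (m / p) + k = (m % p + k) + p * (m / p) by ring,
      Nat.add_mul_div_left _ _ hp]
  simp only [Pi.add_apply, ZMod.val_add]
  rw [key, add_comm (a i).val (((b i).val + (c i).val) % p), key]
  congr 1
  ring

/-- The product
`[x, y, z] [x', y', z'] = [x + x', y + y', z + z' + ⟨x, y'⟩ + carry y y']`. -/
instance : Mul (ModGroup n p) :=
  ⟨fun g h =>
    ⟨g.x + h.x, g.y + h.y, g.z + h.z + ∑ i, g.x i * h.y i + (carry g.y h.y : ZMod p)⟩⟩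

instance : One (ModGroup n p) := ⟨⟨0, 0, 0⟩⟩

instance : Inv (ModGroup n p) :=
  ⟨fun g => ⟨-g.x, -g.y, -g.z + ∑ i, g.x i * g.y i - (carry (-g.y) g.y : ZMod p)⟩⟩

@[simp] theorem mul_x (g h : ModGroup n p) : (g * h).x = g.x + h.x := rfl
@[simp] theorem mul_y (g h : ModGroup n p) : (g * h).y = g.y + h.y := rfl
@[simp] theorem mul_z (g h : ModGroup n p) :
    (g * h).z = g.z + h.z + ∑ i, g.x i * h.y i + (carry g.y h.y : ZMod p) := rfl
@[simp] theorem one_x : (1 : ModGroup n p).x = 0 := rfl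
@[simp] theorem one_y : (1 : ModGroup n p).y = 0 := rfl
@[simp] theorem one_z : (1 : ModGroup n p).z = 0 := rfl
@[simp] theorem inv_x (g : ModGroup n p) : g⁻¹.x = -g.x := rfl
@[simp] theorem inv_y (g : ModGroup n p) : g⁻¹.y = -g.y := rfl
@[simp] theorem inv_z (g : ModGroup n p) :
    g⁻¹.z = -g.z + ∑ i, g.x i * g.y i - (carry (-g.y) g.y : ZMod p) := rfl

instance [NeZero p] : Group (ModGroup n p) :=
  Group.ofLeftAxioms
    (by
      intro a b c
      ext i
      · simp [add_assoc]
      · simp [add_assoc]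
      · have h := congrArg (Nat.cast (R := ZMod p)) (carry_assoc a.y b.y c.y)
        push_cast at h
        simp only [mul_x, mul_y, mul_z, Pi.add_apply, add_mul, mul_add, Finset.sum_add_distrib]
        linear_combination h)
    (by
      intro a
      have h : carry (0 : Fin n → ZMod p) a.y = 0 := by
        refine Finset.sum_eq_zero fun i _ => ?_
        simpa using Nat.div_eq_of_lt (ZMod.val_lt (a.y i))
      ext i <;> simp [h])
    (by
      intro a
      ext i
      · simp
      · simp
      · simp only [mul_z, inv_x, inv_y, inv_z, one_z, Pi.neg_apply, neg_mul,
          Finset.sum_neg_distrib]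
        ring)

/-- A brick of `M_n`: all `[x, y, z]` with `x ∈ X_1 × ⋯ × X_n`, `y ∈ Y_1 × ⋯ × Y_n`, `z ∈ Z`,
for nonempty `X_i, Y_i, Z ⊆ 𝔽_p`. -/
def IsBrick (B : Set (ModGroup n p)) : Prop :=
  ∃ (X Y : Fin n → Set (ZMod p)) (Z : Set (ZMod p)),
    (∀ i, (X i).Nonempty) ∧ (∀ i, (Y i).Nonempty) ∧ Z.Nonempty ∧
    B = {g | (∀ i, g.x i ∈ X i) ∧ (∀ i, g.y i ∈ Y i) ∧ g.z ∈ Z}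

end ModGroup

/-- The cosets of the subgroup `K` that are contained in the set `S`. (The theorem uses it for the
center, for which left and right cosets agree.) -/
def cosetsIn {G : Type*} [Group G] (K : Subgroup G) (S : Set G) : Set (Set G) :=
  {C | (∃ g : G, C = g • (K : Set G)) ∧ C ⊆ S}

/-! A coset of the center is a fibre of [x, y, z] ↦ (x, y). Fix z ∈ Z. The coset over (u, v) lies in
B·B once the central coordinate of [x, v - y, z]·[u - x, y, z], namely 2z + ∑ (x_i y_i + κ(v_i -
y_i, y_i)) with κ the zero function or the carry, takes all values while x_i ∈ X_i ∩ (u_i - X_i) and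
y_i ∈ Y_i ∩ (v_i - Y_i). Since |B| ≤ p ∏ |X_i||Y_i|, it suffices to find ∏ |X_i||Y_i| such pairs (u,
v).

Boundedly many good coordinates K already give all values. The size of B forces |X_i||Y_i| ≥
p^(3/2+ε) for at least nε indices. For large p, restricting (u_i, v_i) on K to popular sums makes
the fibres so large that character sums reach every residue
(`exists_sum_mul_add_eq_of_rpow_le_card_mul_card`). For bounded p, sums with two representations and
Cauchy–Davenport suffice (`exists_sum_mul_add_eq_of_two_le_card`).

The restriction on K costs at most a factor L^k, independent of n. Off K all of X_i + X_i and Y_i +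
Y_i is allowed, and Cauchy–Davenport gains 4/3 in each good coordinate where one of the two sets has
size at most 3p/4. Where both are larger, every sum is popular and nothing is lost. Choosing K
accordingly balances the count (`exists_subset_card_eq_prod_le`). -/

/-! ### Character sums: reaching every residue when p is large. -/

section CharacterSums

variable {p : ℕ} [Fact p.Prime]

/-- Parseval for the indicator function of `A`. -/
theorem sum_norm_sq_sum_stdAddChar (A : Finset (ZMod p)) {t : ZMod p} (ht : t ≠ 0) :
    ∑ b : ZMod p, ‖∑ a ∈ A, ZMod.stdAddChar (t * (a * b))‖ ^ 2 = (p : ℝ) * A.card := by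
  have key : (∑ b : ZMod p, ((‖∑ a ∈ A, ZMod.stdAddChar (t * (a * b))‖ : ℂ)) ^ 2)
      = (p : ℂ) * A.card := by
    have h1 : ∀ b : ZMod p, ((‖∑ a ∈ A, ZMod.stdAddChar (t * (a * b))‖ : ℂ)) ^ 2
        = ∑ a ∈ A, ∑ a' ∈ A, ZMod.stdAddChar (b * (t * (a - a'))) := by
      intro b
      rw [← Complex.mul_conj', map_sum, Finset.sum_mul_sum]
      refine Finset.sum_congr rfl fun a _ => Finset.sum_congr rfl fun a' _ => ?_
      rw [← AddChar.map_neg_eq_conj, ← AddChar.map_add_eq_mul]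
      congr 1
      ring
    simp_rw [h1]
    rw [Finset.sum_comm]
    have h2 : ∀ a ∈ A, ∑ b : ZMod p, ∑ a' ∈ A, ZMod.stdAddChar (b * (t * (a - a'))) = (p : ℂ) := by
      intro a ha
      rw [Finset.sum_comm]
      have h3 : ∀ a' ∈ A, ∑ b : ZMod p, (ZMod.stdAddChar (b * (t * (a - a'))) : ℂ)
          = if a = a' then (p : ℂ) else 0 := by
        intro a' _
        rw [AddChar.sum_mulShift _ (ZMod.isPrimitive_stdAddChar p)]
        simp [ht, sub_eq_zero, ZMod.card]
      rw [Finset.sum_congr rfl h3]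
      simp [ha]
    rw [Finset.sum_congr rfl h2]
    simp [mul_comm]
  exact_mod_cast key

theorem norm_sq_sum_stdAddChar_mul_add_le (A B : Finset (ZMod p)) (c : ZMod p → ZMod p)
    {t : ZMod p} (ht : t ≠ 0) :
    ‖∑ q ∈ A ×ˢ B, ZMod.stdAddChar (t * (q.1 * q.2 + c q.2))‖ ^ 2
      ≤ (p : ℝ) * (A.card * B.card) := by
  have h1 : ‖∑ q ∈ A ×ˢ B, ZMod.stdAddChar (t * (q.1 * q.2 + c q.2))‖
      ≤ ∑ b ∈ B, ‖∑ a ∈ A, ZMod.stdAddChar (t * (a * b))‖ := by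
    -- For fixed `b` the shift `c b` contributes only a common factor of modulus one; this is why
    -- `c` may depend on the second variable alone.
    rw [Finset.sum_product_right]
    refine (norm_sum_le _ _).trans (Finset.sum_le_sum fun b _ => le_of_eq ?_)
    have : ∀ a ∈ A, (ZMod.stdAddChar (t * (a * b + c b)) : ℂ)
        = ZMod.stdAddChar (t * (a * b)) * ZMod.stdAddChar (t * c b) := by
      intro a _
      rw [← AddChar.map_add_eq_mul, mul_add]
    rw [Finset.sum_congr rfl this, ← Finset.sum_mul, norm_mul, AddChar.norm_apply, mul_one]
  calc ‖∑ q ∈ A ×ˢ B, ZMod.stdAddChar (t * (q.1 * q.2 + c q.2))‖ ^ 2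
      ≤ (∑ b ∈ B, ‖∑ a ∈ A, ZMod.stdAddChar (t * (a * b))‖) ^ 2 := by gcongr
    _ ≤ B.card * ∑ b ∈ B, ‖∑ a ∈ A, ZMod.stdAddChar (t * (a * b))‖ ^ 2 :=
        sq_sum_le_card_mul_sum_sq
    _ ≤ B.card * ∑ b : ZMod p, ‖∑ a ∈ A, ZMod.stdAddChar (t * (a * b))‖ ^ 2 := by
        gcongr
        exact Finset.subset_univ B
    _ = (p : ℝ) * (A.card * B.card) := by
        rw [sum_norm_sq_sum_stdAddChar A ht]; ring

/-- By orthogonality p times the number of solutions is ∑ E(t). The term t = 0 is M = ∏ |T_i|, and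
the other p - 1 terms are at most δ^|κ| M each, too little to cancel it. -/
theorem exists_sum_eq_of_norm_sum_stdAddChar_le {κ : Type*} [Fintype κ] {α : Type*}
    (T : κ → Finset α) (hT : ∀ i, (T i).Nonempty) (φ : κ → α → ZMod p) {δ : ℝ}
    (hδ : ∀ i, ∀ t : ZMod p, t ≠ 0 → ‖∑ q ∈ T i, ZMod.stdAddChar (t * φ i q)‖ ≤ δ * (T i).card)
    (hκ : (p : ℝ) * δ ^ Fintype.card κ ≤ 1) (hδ0 : 0 < δ) (s : ZMod p) :
    ∃ f : κ → α, (∀ i, f i ∈ T i) ∧ ∑ i, φ i (f i) = s := by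
  classical
  by_contra! hcon
  set M : ℝ := ∏ i, ((T i).card : ℝ) with hM
  have hMpos : 0 < M := Finset.prod_pos fun i _ => by exact_mod_cast (hT i).card_pos
  let E : ZMod p → ℂ := fun t =>
    ZMod.stdAddChar (-(t * s)) * ∏ i, ∑ q ∈ T i, ZMod.stdAddChar (t * φ i q)
  have hsum : ∀ (t : ZMod p) (f : κ → α),
      ∏ i, (ZMod.stdAddChar (t * φ i (f i)) : ℂ) = ZMod.stdAddChar (t * ∑ i, φ i (f i)) := by
    intro t f
    rw [Finset.mul_sum]
    induction (Finset.univ : Finset κ) using Finset.induction_on with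
    | empty => simp
    | insert a K ha ih =>
      rw [Finset.prod_insert ha, Finset.sum_insert ha, AddChar.map_add_eq_mul, ih]
  have hE : ∑ t, E t = 0 := by
    have h1 : ∀ t, E t = ∑ f ∈ Fintype.piFinset T,
        ZMod.stdAddChar (t * (∑ i, φ i (f i) - s)) := by
      intro t
      simp only [E]
      rw [Finset.prod_univ_sum, Finset.mul_sum]
      refine Finset.sum_congr rfl fun f _ => ?_
      rw [hsum, ← AddChar.map_add_eq_mul]
      congr 1
      ring
    simp_rw [h1]
    rw [Finset.sum_comm]
    refine Finset.sum_eq_zero fun f hf => ?_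
    rw [AddChar.sum_mulShift _ (ZMod.isPrimitive_stdAddChar p),
      if_neg (sub_ne_zero.2 (hcon f (Fintype.mem_piFinset.1 hf)))]
    simp
  have hE0 : E 0 = (M : ℂ) := by simp [E, hM]
  have hEt : ∀ t ≠ 0, ‖E t‖ ≤ δ ^ Fintype.card κ * M := by
    intro t ht
    simp only [E]
    rw [norm_mul, AddChar.norm_apply, one_mul, norm_prod]
    calc ∏ i, ‖∑ q ∈ T i, (ZMod.stdAddChar (t * φ i q) : ℂ)‖
        ≤ ∏ i, (δ * (T i).card) := Finset.prod_le_prod (fun _ _ => norm_nonneg _)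
          fun i _ => hδ i t ht
      _ = δ ^ Fintype.card κ * M := by rw [Finset.prod_mul_distrib]; simp [hM]
  rw [← Finset.add_sum_erase _ _ (Finset.mem_univ (0 : ZMod p)), hE0] at hE
  have h2 : M ≤ ∑ t ∈ Finset.univ.erase (0 : ZMod p), ‖E t‖ := by
    have h3 : (M : ℂ) = -∑ t ∈ Finset.univ.erase (0 : ZMod p), E t := eq_neg_of_add_eq_zero_left hE
    calc M = ‖(M : ℂ)‖ := by simp [abs_of_pos hMpos]
      _ ≤ _ := by rw [h3, norm_neg]; exact norm_sum_le _ _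
  have h4 : ∑ t ∈ Finset.univ.erase (0 : ZMod p), ‖E t‖
      ≤ ((p : ℝ) - 1) * (δ ^ Fintype.card κ * M) := by
    refine (Finset.sum_le_card_nsmul _ _ _ fun t ht => hEt t (Finset.ne_of_mem_erase ht)).trans ?_
    rw [Finset.card_erase_of_mem (Finset.mem_univ _), Finset.card_univ, ZMod.card, nsmul_eq_mul,
      Nat.cast_pred (Fact.out : p.Prime).pos]
  have h5 : 0 < δ ^ Fintype.card κ := by positivity
  nlinarith [mul_pos h5 hMpos]

/-- The bilinear bound p|A||B| ≤ p^(-ε) (|A||B|)² allows δ = p^(-ε/2) in each coordinate, and |K| ≥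
2/ε coordinates bring p δ^|K| down to 1. -/
theorem exists_sum_mul_add_eq_of_rpow_le_card_mul_card {ι : Type*} (K : Finset ι)
    (A B : ι → Finset (ZMod p)) (c : ι → ZMod p → ZMod p) {ε : ℝ}
    (hAB : ∀ i ∈ K, (p : ℝ) ^ (1 + ε) ≤ (A i).card * (B i).card) (hK : 2 ≤ K.card * ε)
    (s : ZMod p) :
    ∃ x y : ι → ZMod p, (∀ i ∈ K, x i ∈ A i ∧ y i ∈ B i) ∧
      ∑ i ∈ K, (x i * y i + c i (y i)) = s := by
  classical
  have hp : (0 : ℝ) < p := by exact_mod_cast (Fact.out : p.Prime).pos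
  have hp1 : (1 : ℝ) ≤ p := by exact_mod_cast (Fact.out : p.Prime).one_le
  have hδ0 : 0 < (p : ℝ) ^ (-(ε / 2)) := Real.rpow_pos_of_pos hp _
  have hδ2 : ((p : ℝ) ^ (-(ε / 2))) ^ 2 = (p : ℝ) ^ (-ε) := by
    rw [← Real.rpow_natCast, ← Real.rpow_mul hp.le]; congr 1; push_cast; ring
  obtain ⟨f, hf, hfs⟩ := exists_sum_eq_of_norm_sum_stdAddChar_le (κ := K)
    (T := fun i => A i ×ˢ B i)
    (fun i => by
      have h1 := (Real.rpow_pos_of_pos hp (1 + ε)).trans_le (hAB i i.2)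
      have h2 : 0 < (A i).card * (B i).card := by exact_mod_cast h1
      rw [← Finset.card_product] at h2
      exact Finset.card_pos.1 h2)
    (fun i q => q.1 * q.2 + c i q.2) (δ := (p : ℝ) ^ (-(ε / 2)))
    (fun i t ht => by
      have h1 := norm_sq_sum_stdAddChar_mul_add_le (A i) (B i) (c i) ht
      refine le_of_sq_le_sq (h1.trans ?_) (by positivity)
      rw [Finset.card_product, mul_pow, hδ2]
      push_cast
      have h2 := hAB i i.2
      have h3 : (p : ℝ) ≤ (p : ℝ) ^ (-ε) * ((A i).card * (B i).card) := by
        calc (p : ℝ) = (p : ℝ) ^ (-ε) * (p : ℝ) ^ (1 + ε) := by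
              rw [← Real.rpow_add hp]; simp
          _ ≤ _ := by gcongr
      calc (p : ℝ) * ((A i).card * (B i).card)
          ≤ ((p : ℝ) ^ (-ε) * ((A i).card * (B i).card)) * ((A i).card * (B i).card) := by gcongr
        _ = _ := by ring)
    (by
      rw [Fintype.card_coe, ← Real.rpow_natCast, ← Real.rpow_mul hp.le]
      calc (p : ℝ) * (p : ℝ) ^ (-(ε / 2) * (K.card : ℝ))
          = (p : ℝ) ^ (1 + -(ε / 2) * (K.card : ℝ)) := by rw [Real.rpow_add hp, Real.rpow_one]
        _ ≤ (p : ℝ) ^ (0 : ℝ) := by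
            apply Real.rpow_le_rpow_of_exponent_le hp1; linarith
        _ = 1 := Real.rpow_zero _)
    hδ0 s
  refine ⟨fun i => if h : i ∈ K then (f ⟨i, h⟩).1 else 0,
    fun i => if h : i ∈ K then (f ⟨i, h⟩).2 else 0, ?_, ?_⟩
  · intro i hi
    simpa [hi] using hf ⟨i, hi⟩
  · rw [← hfs, ← Finset.sum_coe_sort K]
    simp

end CharacterSums

/-! ### Cauchy–Davenport: reaching every residue when p is bounded. -/

section CauchyDavenport

variable {p : ℕ} [Fact p.Prime]

theorem min_le_card_sum_of_two_le_card {ι : Type*} (K : Finset ι) (S : ι → Finset (ZMod p))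
    (hS : ∀ i ∈ K, 2 ≤ (S i).card) : min p (K.card + 1) ≤ (∑ i ∈ K, S i).card := by
  classical
  induction K using Finset.induction_on with
  | empty => simp
  | insert a K ha ih =>
    have h1 := ih fun i hi => hS i (Finset.mem_insert_of_mem hi)
    have h2 := hS a (Finset.mem_insert_self a K)
    have hp := (Fact.out : p.Prime).two_le
    rw [Finset.sum_insert ha, Finset.card_insert_of_notMem ha]
    have h3 := ZMod.cauchy_davenport (Fact.out : p.Prime) (s := S a) (t := ∑ i ∈ K, S i)
      (Finset.card_pos.1 (by omega)) (Finset.card_pos.1 (by omega))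
    omega

theorem exists_sum_mul_add_eq_of_two_le_card {ι : Type*} (K : Finset ι)
    (A B : ι → Finset (ZMod p)) (c : ι → ZMod p → ZMod p)
    (hA : ∀ i ∈ K, 2 ≤ (A i).card) (hB : ∀ i ∈ K, ∃ b ∈ B i, b ≠ 0) (hK : p ≤ K.card + 1)
    (s : ZMod p) :
    ∃ x y : ι → ZMod p, (∀ i ∈ K, x i ∈ A i ∧ y i ∈ B i) ∧
      ∑ i ∈ K, (x i * y i + c i (y i)) = s := by
  classical
  let S : ι → Finset (ZMod p) := fun i => (A i ×ˢ B i).image fun q => q.1 * q.2 + c i q.2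
  have hS : ∀ i ∈ K, 2 ≤ (S i).card := by
    intro i hi
    obtain ⟨b, hb, hb0⟩ := hB i hi
    -- With a nonzero `b` fixed, `a ↦ a * b + c i b` is injective, so two choices of `a` give two
    -- values.
    have h1 : (A i).image (fun a => a * b + c i b) ⊆ S i := by
      intro z hz
      obtain ⟨a, ha, rfl⟩ := Finset.mem_image.1 hz
      exact Finset.mem_image.2 ⟨(a, b), Finset.mem_product.2 ⟨ha, hb⟩, rfl⟩
    have h2 : ((A i).image (fun a => a * b + c i b)).card = (A i).card :=
      Finset.card_image_of_injective _ fun a a' h => mul_right_cancel₀ hb0 (add_right_cancel h)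
    exact (hA i hi).trans (h2 ▸ Finset.card_le_card h1)
  have h1 : p ≤ (∑ i ∈ K, S i).card := by
    have := min_le_card_sum_of_two_le_card K S hS
    omega
  have h2 : ∑ i ∈ K, S i = Finset.univ :=
    Finset.eq_univ_of_card _ (le_antisymm (Finset.card_le_univ _) (by rwa [ZMod.card]))
  have h3 : s ∈ ((∑ i ∈ K, S i : Finset (ZMod p)) : Set (ZMod p)) := by rw [h2]; simp
  rw [Finset.coe_sum, Set.mem_finsetSum] at h3
  obtain ⟨g, hg, hgs⟩ := h3
  have h4 : ∀ i, ∃ q : ZMod p × ZMod p, i ∈ K →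
      q.1 ∈ A i ∧ q.2 ∈ B i ∧ q.1 * q.2 + c i q.2 = g i := by
    intro i
    by_cases hi : i ∈ K
    · obtain ⟨q, hq, hqg⟩ := Finset.mem_image.1 (Finset.mem_coe.1 (hg hi))
      exact ⟨q, fun _ => ⟨(Finset.mem_product.1 hq).1, (Finset.mem_product.1 hq).2, hqg⟩⟩
    · exact ⟨0, fun h => absurd h hi⟩
  choose q hq using h4
  refine ⟨fun i => (q i).1, fun i => (q i).2, fun i hi => ⟨(hq i hi).1, (hq i hi).2.1⟩, ?_⟩
  rw [← hgs]
  exact Finset.sum_congr rfl fun i hi => (hq i hi).2.2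

end CauchyDavenport

/-! ### Choosing the coordinates to restrict. -/

section Selection

/-- `J` collects the coordinates where restriction is free. If it has k elements, K is taken inside
it. Otherwise K is taken in `I \ J`: it costs L^k, while the at least |I| - 2k remaining coordinates
`R` of `I \ J` each gain 4/3. -/
theorem exists_subset_card_eq_prod_le {ι : Type*} [Fintype ι] [DecidableEq ι] (I : Finset ι)
    (w g N : ι → ℝ) {L : ℝ} {k : ℕ} (hw : ∀ i, 0 ≤ w i) (hg : ∀ i, 0 ≤ g i)
    (hwN : ∀ i, w i ≤ N i) (hL1 : 0 ≤ L) (hL : ∀ i ∈ I, w i ≤ L * g i)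
    (hd : ∀ i ∈ I, w i ≤ g i ∨ 4 * w i ≤ 3 * N i) (hk : 2 * k ≤ I.card)
    (hI : L ^ k * (3 / 4 : ℝ) ^ (I.card - 2 * k) ≤ 1) :
    ∃ K ⊆ I, K.card = k ∧ ∏ i, w i ≤ ∏ i, if i ∈ K then g i else N i := by
  set J := I.filter fun i => w i ≤ g i with hJ
  by_cases hkJ : k ≤ J.card
  · obtain ⟨K, hKJ, hKk⟩ := Finset.exists_subset_card_eq hkJ
    refine ⟨K, hKJ.trans (Finset.filter_subset _ _), hKk,
      Finset.prod_le_prod (fun i _ => hw i) fun i _ => ?_⟩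
    split_ifs with h
    · exact (Finset.mem_filter.1 (hKJ h)).2
    · exact hwN i
  · have hJI : J ⊆ I := Finset.filter_subset _ _
    have hc : (I \ J).card = I.card - J.card := Finset.card_sdiff_of_subset hJI
    obtain ⟨K, hKJ, hKk⟩ := Finset.exists_subset_card_eq (s := I \ J) (n := k) (by omega)
    set R := (I \ J) \ K with hR
    have hRc : R.card = (I \ J).card - k := by
      rw [hR, Finset.card_sdiff_of_subset hKJ, hKk]
    refine ⟨K, hKJ.trans Finset.sdiff_subset, hKk, ?_⟩
    have h1 : ∀ i, w i ≤ ((if i ∈ K then L else 1) * (if i ∈ R then (3 / 4 : ℝ) else 1)) *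
        (if i ∈ K then g i else N i) := by
      intro i
      by_cases hiK : i ∈ K
      · have : i ∉ R := fun h => (Finset.mem_sdiff.1 h).2 hiK
        simp only [hiK, this, if_true, if_false, mul_one]
        exact hL i (Finset.mem_sdiff.1 (hKJ hiK)).1
      · by_cases hiR : i ∈ R
        · simp only [hiK, hiR, if_true, if_false, one_mul]
          obtain ⟨h2, h3⟩ := Finset.mem_sdiff.1 (Finset.mem_sdiff.1 hiR).1
          rcases hd i h2 with h | h
          · exact absurd (Finset.mem_filter.2 ⟨h2, h⟩) h3
          · linarith
        · simp only [hiK, hiR, if_false, one_mul]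
          exact hwN i
    have hN : ∀ i, 0 ≤ if i ∈ K then g i else N i := by
      intro i
      split_ifs
      exacts [hg i, (hw i).trans (hwN i)]
    calc ∏ i, w i ≤ ∏ i, (((if i ∈ K then L else 1) * (if i ∈ R then (3 / 4 : ℝ) else 1)) *
          (if i ∈ K then g i else N i)) := Finset.prod_le_prod (fun i _ => hw i) fun i _ => h1 i
      _ = (L ^ k * (3 / 4 : ℝ) ^ R.card) * ∏ i, (if i ∈ K then g i else N i) := by
          rw [Finset.prod_mul_distrib, Finset.prod_mul_distrib]
          simp [Finset.prod_ite_mem, hKk, div_pow]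
      _ ≤ 1 * ∏ i, (if i ∈ K then g i else N i) := by
          refine mul_le_mul_of_nonneg_right ?_ (Finset.prod_nonneg fun i _ => hN i)
          refine le_trans ?_ hI
          refine mul_le_mul_of_nonneg_left ?_ (pow_nonneg hL1 k)
          exact pow_le_pow_of_le_one (by norm_num) (by norm_num) (by omega)
      _ = _ := one_mul _

theorem exists_forall_pow_mul_pow_le_one (L : ℝ) (hL : 0 < L) (k : ℕ) :
    ∃ m₀ : ℕ, ∀ m, m₀ ≤ m → 2 * k ≤ m ∧ L ^ k * (3 / 4 : ℝ) ^ (m - 2 * k) ≤ 1 := by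
  obtain ⟨N, hN⟩ := exists_pow_lt_of_lt_one (inv_pos.2 (pow_pos hL k))
    (show (3 / 4 : ℝ) < 1 by norm_num)
  refine ⟨2 * k + N, fun m hm => ⟨by omega, ?_⟩⟩
  have h1 : (3 / 4 : ℝ) ^ (m - 2 * k) ≤ (L ^ k)⁻¹ :=
    (pow_le_pow_of_le_one (by norm_num) (by norm_num) (by omega)).trans hN.le
  calc L ^ k * (3 / 4 : ℝ) ^ (m - 2 * k) ≤ L ^ k * (L ^ k)⁻¹ := by gcongr
    _ = 1 := mul_inv_cancel₀ (pow_pos hL k).ne'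

end Selection

/-! ### Representations of sums in X + X. -/

section Fibers

variable {p : ℕ}

/-- The elements `a` of `X` for which `u - a` is in `X` too. -/
def sumFiber (X : Finset (ZMod p)) (u : ZMod p) : Finset (ZMod p) := X.filter fun a => u - a ∈ X

theorem mem_sumFiber {X : Finset (ZMod p)} {u a : ZMod p} :
    a ∈ sumFiber X u ↔ a ∈ X ∧ u - a ∈ X := Finset.mem_filter

theorem sumFiber_nonempty {X : Finset (ZMod p)} {u : ZMod p} (hu : u ∈ X + X) :
    (sumFiber X u).Nonempty := by
  obtain ⟨a, ha, b, hb, rfl⟩ := Finset.mem_add.1 hu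
  exact ⟨a, mem_sumFiber.2 ⟨ha, by simpa using hb⟩⟩

variable [Fact p.Prime]

theorem card_finset_le (X : Finset (ZMod p)) : X.card ≤ p := by
  simpa [ZMod.card] using Finset.card_le_univ X

theorem sum_card_sumFiber (X : Finset (ZMod p)) : ∑ u, (sumFiber X u).card = X.card ^ 2 := by
  have h : ∀ u, (sumFiber X u).card = ∑ a ∈ X, if u - a ∈ X then 1 else 0 := fun u => by
    rw [sumFiber, Finset.card_filter]
  simp_rw [h]
  rw [Finset.sum_comm]
  have h2 : ∀ a ∈ X, ∑ u : ZMod p, (if u - a ∈ X then 1 else 0) = X.card := by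
    intro a _
    refine ((Equiv.subRight a).sum_comp (fun u => if u ∈ X then 1 else 0)).trans ?_
    simp
  rw [Finset.sum_congr rfl h2]
  simp [sq]

/-- The fibre is X ∩ (u - X), an intersection of two sets of size |X| among p residues. -/
theorem two_mul_card_le_card_sumFiber_add (X : Finset (ZMod p)) (u : ZMod p) :
    2 * X.card ≤ (sumFiber X u).card + p := by
  have h1 : sumFiber X u = X ∩ X.image (fun a => u - a) := by
    ext a
    simp only [mem_sumFiber, Finset.mem_inter, Finset.mem_image]
    refine and_congr_right fun _ => ⟨fun h => ⟨u - a, h, by ring⟩, ?_⟩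
    rintro ⟨b, hb, rfl⟩
    simpa using hb
  have h2 : (X.image (fun a => u - a)).card = X.card :=
    Finset.card_image_of_injective _ sub_right_injective
  have h3 := Finset.card_union_add_card_inter X (X.image fun a => u - a)
  have h4 := card_finset_le (X ∪ X.image fun a => u - a)
  rw [h1]
  omega

theorem four_mul_card_le_three_mul_card_add {X : Finset (ZMod p)} (h2 : 2 ≤ X.card)
    (hX : 4 * X.card ≤ 3 * p) : 4 * X.card ≤ 3 * (X + X).card := by
  have h := ZMod.cauchy_davenport (Fact.out : p.Prime) (s := X) (t := X)
    (Finset.card_pos.1 (by omega)) (Finset.card_pos.1 (by omega))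
  omega

/-- The sums in `X + X` with at least half of the average number of representations. -/
def popularSums (X : Finset (ZMod p)) : Finset (ZMod p) :=
  Finset.univ.filter fun u => X.card ^ 2 ≤ 2 * p * (sumFiber X u).card

/-- Unpopular sums account for at most half of the |X|² representations, and a popular sum has at
most |X| of them. -/
theorem card_le_two_mul_card_popularSums (X : Finset (ZMod p)) :
    X.card ≤ 2 * (popularSums X).card := by
  rcases X.eq_empty_or_nonempty with rfl | hX
  · simp
  have hp : 0 < p := (Fact.out : p.Prime).pos
  have h0 := sum_card_sumFiber X
  rw [← Finset.sum_filter_add_sum_filter_not Finset.univ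
    (fun u => X.card ^ 2 ≤ 2 * p * (sumFiber X u).card)] at h0
  have h1 : ∑ u ∈ popularSums X, (sumFiber X u).card ≤ (popularSums X).card * X.card := by
    rw [← smul_eq_mul]
    exact Finset.sum_le_card_nsmul _ _ _ fun u _ => Finset.card_filter_le _ _
  set Q := Finset.univ.filter fun u => ¬ X.card ^ 2 ≤ 2 * p * (sumFiber X u).card with hQ
  have h2 : 2 * p * ∑ u ∈ Q, (sumFiber X u).card ≤ p * X.card ^ 2 := by
    rw [Finset.mul_sum]
    calc ∑ u ∈ Q, 2 * p * (sumFiber X u).card ≤ Q.card • (X.card ^ 2) :=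
          Finset.sum_le_card_nsmul _ _ _ fun u hu => (not_le.1 (Finset.mem_filter.1 hu).2).le
      _ ≤ p * X.card ^ 2 := by
          rw [smul_eq_mul]; exact Nat.mul_le_mul_right _ (card_finset_le Q)
  have h3 : 2 * ∑ u ∈ Q, (sumFiber X u).card ≤ X.card ^ 2 := by
    refine Nat.le_of_mul_le_mul_left ?_ hp
    linarith
  change ∑ u ∈ popularSums X, (sumFiber X u).card + _ = _ at h0
  refine Nat.le_of_mul_le_mul_right ?_ hX.card_pos
  nlinarith

theorem popularSums_eq_univ {X : Finset (ZMod p)} (hX : 3 * p < 4 * X.card) :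
    popularSums X = Finset.univ := by
  refine Finset.filter_true_of_mem fun u _ => ?_
  have h1 := two_mul_card_le_card_sumFiber_add X u
  have h2 := card_finset_le X
  nlinarith

/-- The sums in `X + X` with at least two representations. -/
def repeatedSums (X : Finset (ZMod p)) : Finset (ZMod p) :=
  Finset.univ.filter fun u => 2 ≤ (sumFiber X u).card

theorem repeatedSums_nonempty {X : Finset (ZMod p)} (hX : 2 ≤ X.card) :
    (repeatedSums X).Nonempty := by
  obtain ⟨a, ha, b, hb, hab⟩ := Finset.one_lt_card.1 hX
  refine ⟨a + b, Finset.mem_filter.2 ⟨Finset.mem_univ _, Finset.one_lt_card.2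
    ⟨a, mem_sumFiber.2 ⟨ha, ?_⟩, b, mem_sumFiber.2 ⟨hb, ?_⟩, hab⟩⟩⟩ <;> simpa

theorem repeatedSums_eq_univ {X : Finset (ZMod p)} (hX : 3 * p < 4 * X.card) :
    repeatedSums X = Finset.univ := by
  refine Finset.filter_true_of_mem fun u _ => ?_
  have h1 := two_mul_card_le_card_sumFiber_add X u
  have hp := (Fact.out : p.Prime).two_le
  have h2 := card_finset_le X
  omega

end Fibers

/-! ### Counting the pairs (u, v) whose fibre is covered. -/

section Covering

variable {n p : ℕ}

/-- Every residue is of the form `∑ i, (x i * y i + c (v i) (y i))`, where `u i` is the sum of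
`x i` and another element of `X i`, and `v i` the sum of `y i` and another element of `Y i`. -/
def CoversFiber (X Y : Fin n → Finset (ZMod p)) (c : ZMod p → ZMod p → ZMod p)
    (q : Fin n → ZMod p × ZMod p) : Prop :=
  ∀ s, ∃ x y : Fin n → ZMod p,
    (∀ i, x i ∈ sumFiber (X i) (q i).1 ∧ y i ∈ sumFiber (Y i) (q i).2) ∧
      ∑ i, (x i * y i + c (q i).2 (y i)) = s

/-- Off K any representation is frozen; its contribution only translates the target `s`. -/
theorem coversFiber_of_subset {X Y : Fin n → Finset (ZMod p)} {c : ZMod p → ZMod p → ZMod p}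
    {q : Fin n → ZMod p × ZMod p} (K : Finset (Fin n))
    (hq : ∀ i ∉ K, q i ∈ (X i + X i) ×ˢ (Y i + Y i))
    (hK : ∀ s, ∃ x y : Fin n → ZMod p,
      (∀ i ∈ K, x i ∈ sumFiber (X i) (q i).1 ∧ y i ∈ sumFiber (Y i) (q i).2) ∧
      ∑ i ∈ K, (x i * y i + c (q i).2 (y i)) = s) :
    CoversFiber X Y c q := by
  intro s
  have h1 : ∀ i, ∃ r : ZMod p × ZMod p, i ∉ K →
      r.1 ∈ sumFiber (X i) (q i).1 ∧ r.2 ∈ sumFiber (Y i) (q i).2 := by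
    intro i
    by_cases hi : i ∈ K
    · exact ⟨0, fun h => absurd hi h⟩
    · obtain ⟨h2, h3⟩ := Finset.mem_product.1 (hq i hi)
      obtain ⟨a, ha⟩ := sumFiber_nonempty h2
      obtain ⟨b, hb⟩ := sumFiber_nonempty h3
      exact ⟨(a, b), fun _ => ⟨ha, hb⟩⟩
  choose r hr using h1
  obtain ⟨x, y, hxy, hs⟩ := hK (s - ∑ i ∈ Kᶜ, ((r i).1 * (r i).2 + c (q i).2 (r i).2))
  refine ⟨fun i => if i ∈ K then x i else (r i).1, fun i => if i ∈ K then y i else (r i).2,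
    fun i => ?_, ?_⟩
  · by_cases hi : i ∈ K
    · simpa [hi] using hxy i hi
    · simpa [hi] using hr i hi
  · rw [← Finset.sum_add_sum_compl K]
    have h2 : ∀ i ∈ K, ((if i ∈ K then x i else (r i).1) * (if i ∈ K then y i else (r i).2)
        + c (q i).2 (if i ∈ K then y i else (r i).2)) = x i * y i + c (q i).2 (y i) := by
      intro i hi; simp [hi]
    have h3 : ∀ i ∈ Kᶜ, ((if i ∈ K then x i else (r i).1) * (if i ∈ K then y i else (r i).2)
        + c (q i).2 (if i ∈ K then y i else (r i).2))
        = (r i).1 * (r i).2 + c (q i).2 (r i).2 := by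
      intro i hi; simp [Finset.mem_compl.1 hi]
    rw [Finset.sum_congr rfl h2, Finset.sum_congr rfl h3, hs]
    ring

variable [Fact p.Prime]

/-- Common to both ranges of p: `U`, `V` will be popular sums or repeated sums. The dichotomy at
3p/4 supplies the hypothesis `hd` of the selection lemma. -/
theorem exists_finset_coversFiber {X Y : Fin n → Finset (ZMod p)}
    {c : ZMod p → ZMod p → ZMod p} (I : Finset (Fin n)) (U V : Fin n → Finset (ZMod p))
    {L : ℝ} (hL0 : 0 ≤ L) {k : ℕ}
    (hX2 : ∀ i ∈ I, 2 ≤ (X i).card) (hY2 : ∀ i ∈ I, 2 ≤ (Y i).card)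
    (hU : ∀ i ∈ I, 3 * p < 4 * (X i).card → U i = Finset.univ)
    (hV : ∀ i ∈ I, 3 * p < 4 * (Y i).card → V i = Finset.univ)
    (hL : ∀ i ∈ I, ((X i).card * (Y i).card : ℝ) ≤ L * ((U i).card * (V i).card))
    (hk : 2 * k ≤ I.card) (hI : L ^ k * (3 / 4 : ℝ) ^ (I.card - 2 * k) ≤ 1)
    (hcov : ∀ K ⊆ I, K.card = k → ∀ q : Fin n → ZMod p × ZMod p,
      (∀ i ∈ K, (q i).1 ∈ U i ∧ (q i).2 ∈ V i) → ∀ s, ∃ x y : Fin n → ZMod p,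
      (∀ i ∈ K, x i ∈ sumFiber (X i) (q i).1 ∧ y i ∈ sumFiber (Y i) (q i).2) ∧
      ∑ i ∈ K, (x i * y i + c (q i).2 (y i)) = s) :
    ∃ W : Finset (Fin n → ZMod p × ZMod p),
      ∏ i, (X i).card * (Y i).card ≤ W.card ∧ ∀ q ∈ W, CoversFiber X Y c q := by
  have hle : ∀ S : Finset (ZMod p), (S.card : ℝ) ≤ (S + S).card := fun S => by
    exact_mod_cast Finset.card_le_card_add_self
  obtain ⟨K, hKI, hKk, hprod⟩ := exists_subset_card_eq_prod_le I
    (fun i => ((X i).card * (Y i).card : ℝ)) (fun i => ((U i).card * (V i).card : ℝ))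
    (fun i => ((X i + X i).card * (Y i + Y i).card : ℝ))
    (fun i => by positivity) (fun i => by positivity)
    (fun i => mul_le_mul (hle _) (hle _) (by positivity) (by positivity)) hL0 hL
    (fun i hi => by
      by_cases h1 : 3 * p < 4 * (X i).card
      · by_cases h2 : 3 * p < 4 * (Y i).card
        · left
          rw [hU i hi h1, hV i hi h2]
          exact mul_le_mul (by exact_mod_cast Finset.card_le_univ _)
            (by exact_mod_cast Finset.card_le_univ _) (by positivity) (by positivity)
        · right
          have h3 : (4 * (Y i).card : ℝ) ≤ 3 * (Y i + Y i).card := by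
            exact_mod_cast four_mul_card_le_three_mul_card_add (hY2 i hi) (not_lt.1 h2)
          have h4 := mul_le_mul (hle (X i)) h3 (by positivity) (by positivity)
          linarith
      · right
        have h3 : (4 * (X i).card : ℝ) ≤ 3 * (X i + X i).card := by
          exact_mod_cast four_mul_card_le_three_mul_card_add (hX2 i hi) (not_lt.1 h1)
        have h4 := mul_le_mul h3 (hle (Y i)) (by positivity) (by positivity)
        linarith) hk hI
  refine ⟨Fintype.piFinset fun i => if i ∈ K then U i ×ˢ V i else (X i + X i) ×ˢ (Y i + Y i),
    ?_, fun q hq => ?_⟩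
  · rw [Fintype.card_piFinset]
    have h5 : ∀ i, ((if i ∈ K then U i ×ˢ V i else (X i + X i) ×ˢ (Y i + Y i)).card : ℝ)
        = if i ∈ K then ((U i).card * (V i).card : ℝ)
          else ((X i + X i).card * (Y i + Y i).card : ℝ) := by
      intro i
      split_ifs <;> simp [Finset.card_product]
    have h6 : ((∏ i, (X i).card * (Y i).card : ℕ) : ℝ) ≤
        ((∏ i, (if i ∈ K then U i ×ˢ V i else (X i + X i) ×ˢ (Y i + Y i)).card : ℕ) : ℝ) := by
      push_cast
      simp_rw [h5]
      exact hprod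
    exact_mod_cast h6
  · rw [Fintype.mem_piFinset] at hq
    refine coversFiber_of_subset K (fun i hi => by simpa only [hi, if_false] using hq i)
      (hcov K hKI hKk q fun i hi => ?_)
    have h7 := hq i
    simp only [hi, if_true] at h7
    exact Finset.mem_product.1 h7

/-- With factors bounded by p² on I and by p^(3/2+ε) elsewhere, comparing exponents gives nε + ε -
1/4 < (1/2 - ε)|I|; nε ≥ 1 absorbs the 1/4. -/
theorem le_card_filter_rpow_le {X Y : Fin n → Finset (ZMod p)} {ε : ℝ} (hn : 1 ≤ n * ε)
    (hε : 0 < ε)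
    (hXY : (p : ℝ) ^ ((2 * n + 1) * (3 / 4 + ε)) < p * ∏ i, ((X i).card * (Y i).card : ℝ)) :
    n * ε ≤ (Finset.univ.filter fun i =>
      (p : ℝ) ^ (3 / 2 + ε) ≤ ((X i).card * (Y i).card : ℝ)).card := by
  have hp1 : (1 : ℝ) < p := by exact_mod_cast (Fact.out : p.Prime).one_lt
  have hp : (0 : ℝ) < p := by linarith
  set I := Finset.univ.filter fun i =>
      (p : ℝ) ^ (3 / 2 + ε) ≤ ((X i).card * (Y i).card : ℝ) with hI
  have hle : ∀ S : Finset (ZMod p), (S.card : ℝ) ≤ p := fun S => by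
    exact_mod_cast card_finset_le S
  have h1 : ∏ i, ((X i).card * (Y i).card : ℝ)
      ≤ (p : ℝ) ^ (2 * (I.card : ℝ) + (3 / 2 + ε) * (n - I.card)) := by
    calc ∏ i, ((X i).card * (Y i).card : ℝ)
        ≤ ∏ i, if i ∈ I then (p : ℝ) ^ (2 : ℝ) else (p : ℝ) ^ (3 / 2 + ε) := by
          refine Finset.prod_le_prod (fun i _ => by positivity) fun i _ => ?_
          split_ifs with h
          · rw [Real.rpow_two, sq]
            exact mul_le_mul (hle _) (hle _) (by positivity) hp.le
          · simp only [hI, Finset.mem_filter, Finset.mem_univ, true_and, not_le] at h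
            exact h.le
      _ = ((p : ℝ) ^ (2 : ℝ)) ^ (I.card : ℝ) * ((p : ℝ) ^ (3 / 2 + ε)) ^ (n - I.card : ℝ) := by
          rw [Finset.prod_ite, Finset.prod_const, Finset.prod_const, Finset.filter_mem_eq_inter,
            Finset.univ_inter, Finset.filter_notMem_eq_sdiff, ← Finset.compl_eq_univ_sdiff,
            Finset.card_compl, Fintype.card_fin, ← Real.rpow_natCast, ← Real.rpow_natCast,
            Nat.cast_sub (by simpa using Finset.card_le_univ I)]
      _ = _ := by rw [← Real.rpow_mul hp.le, ← Real.rpow_mul hp.le, ← Real.rpow_add hp]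
  have h2 : (p : ℝ) ^ ((2 * n + 1) * (3 / 4 + ε))
      < (p : ℝ) ^ (1 + (2 * (I.card : ℝ) + (3 / 2 + ε) * (n - I.card))) := by
    rw [Real.rpow_add hp, Real.rpow_one]
    exact hXY.trans_le (by gcongr)
  rw [Real.rpow_lt_rpow_left_iff hp1] at h2
  have h3 : 0 ≤ (I.card : ℝ) * ε := by positivity
  nlinarith

theorem exists_forall_exists_finset_coversFiber {ε : ℝ} (hε : 0 < ε) :
    ∃ n₀ : ℕ, 0 < n₀ ∧ ∀ n : ℕ, n₀ ≤ n → ∀ (p : ℕ) [Fact p.Prime]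
      (X Y : Fin n → Finset (ZMod p)) (c : ZMod p → ZMod p → ZMod p),
      (p : ℝ) ^ ((2 * n + 1) * (3 / 4 + ε)) < p * ∏ i, ((X i).card * (Y i).card : ℝ) →
      ∃ W : Finset (Fin n → ZMod p × ZMod p),
        ∏ i, (X i).card * (Y i).card ≤ W.card ∧ ∀ q ∈ W, CoversFiber X Y c q := by
  -- From this threshold on, p^ε ≥ 4, which pays for the two factors 2 in the definition of popular
  -- sums.
  obtain ⟨P, hP⟩ := exists_nat_ge ((4 : ℝ) ^ (1 / ε))
  have hPpos : (0 : ℝ) < P := (Real.rpow_pos_of_pos (by norm_num) _).trans_le hP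
  obtain ⟨m₁, hm₁⟩ := exists_forall_pow_mul_pow_le_one 4 (by norm_num) ⌈2 / ε⌉₊
  obtain ⟨m₂, hm₂⟩ := exists_forall_pow_mul_pow_le_one ((P : ℝ) ^ 2) (by positivity) P
  -- The added 1 secures nε ≥ 1.
  refine ⟨⌈((max m₁ m₂ : ℕ) + 1 : ℝ) / ε⌉₊, Nat.ceil_pos.2 (by positivity), ?_⟩
  intro n hn p _ X Y c hXY
  have hn' : ((max m₁ m₂ : ℕ) + 1 : ℝ) ≤ n * ε := by
    rw [← div_le_iff₀ hε]
    exact Nat.ceil_le.1 hn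
  have hp1 : (1 : ℝ) < p := by exact_mod_cast (Fact.out : p.Prime).one_lt
  have hp : (0 : ℝ) < p := by linarith
  have hcard := le_card_filter_rpow_le (X := X) (Y := Y)
    (by have : (0 : ℝ) ≤ (max m₁ m₂ : ℕ) := by positivity
        linarith) hε hXY
  set I := Finset.univ.filter fun i =>
      (p : ℝ) ^ (3 / 2 + ε) ≤ ((X i).card * (Y i).card : ℝ) with hI
  have hIm : max m₁ m₂ ≤ I.card := by
    have : ((max m₁ m₂ : ℕ) : ℝ) ≤ I.card := by linarith
    exact_mod_cast this
  have hmem : ∀ i ∈ I, (p : ℝ) ^ (3 / 2 + ε) ≤ ((X i).card * (Y i).card : ℝ) := fun i hi =>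
    (Finset.mem_filter.1 hi).2
  have hlt : ∀ i ∈ I, p < (X i).card * (Y i).card := by
    intro i hi
    have h1 : (p : ℝ) < ((X i).card * (Y i).card : ℝ) := by
      refine lt_of_lt_of_le ?_ (hmem i hi)
      conv_lhs => rw [← Real.rpow_one (p : ℝ)]
      exact Real.rpow_lt_rpow_of_exponent_lt hp1 (by linarith)
    exact_mod_cast h1
  have hX2 : ∀ i ∈ I, 2 ≤ (X i).card := by
    intro i hi
    have h1 := hlt i hi
    have h2 := card_finset_le (Y i)
    by_contra! h
    nlinarith
  have hY2 : ∀ i ∈ I, 2 ≤ (Y i).card := by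
    intro i hi
    have h1 := hlt i hi
    have h2 := card_finset_le (X i)
    by_contra! h
    nlinarith
  by_cases hpP : P ≤ p
  · obtain ⟨hk, hkI⟩ := hm₁ I.card ((le_max_left _ _).trans hIm)
    have hpε : (4 : ℝ) ≤ (p : ℝ) ^ ε := by
      have h1 : (4 : ℝ) ^ (1 / ε) ≤ p := hP.trans (by exact_mod_cast hpP)
      calc (4 : ℝ) = ((4 : ℝ) ^ (1 / ε)) ^ ε := by
            rw [← Real.rpow_mul (by norm_num), one_div, inv_mul_cancel₀ hε.ne', Real.rpow_one]
        _ ≤ (p : ℝ) ^ ε := Real.rpow_le_rpow (by positivity) h1 hε.le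
    refine exists_finset_coversFiber I (fun i => popularSums (X i)) (fun i => popularSums (Y i))
      (by norm_num) hX2 hY2 (fun i _ => popularSums_eq_univ) (fun i _ => popularSums_eq_univ)
      (fun i _ => ?_) hk hkI (fun K hKI hKk q hq s => ?_)
    · have h1 : ((X i).card : ℝ) ≤ 2 * (popularSums (X i)).card := by
        exact_mod_cast card_le_two_mul_card_popularSums (X i)
      have h2 : ((Y i).card : ℝ) ≤ 2 * (popularSums (Y i)).card := by
        exact_mod_cast card_le_two_mul_card_popularSums (Y i)
      have h3 := mul_le_mul h1 h2 (by positivity) (by positivity)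
      linarith
    · refine exists_sum_mul_add_eq_of_rpow_le_card_mul_card K
        (fun i => sumFiber (X i) (q i).1) (fun i => sumFiber (Y i) (q i).2)
        (fun i => c (q i).2) (ε := ε) (fun i hi => ?_) ?_ s
      -- The product of the fibre sizes is at least (|X||Y|)²/(4p²) ≥ p^(1+2ε)/4 ≥ p^(1+ε).
      · have h1 : ((X i).card : ℝ) ^ 2 ≤ 2 * p * (sumFiber (X i) (q i).1).card := by
          exact_mod_cast (Finset.mem_filter.1 (hq i hi).1).2
        have h2 : ((Y i).card : ℝ) ^ 2 ≤ 2 * p * (sumFiber (Y i) (q i).2).card := by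
          exact_mod_cast (Finset.mem_filter.1 (hq i hi).2).2
        have h3 := mul_le_mul h1 h2 (by positivity) (by positivity)
        have h4 : (p : ℝ) ^ (3 + 2 * ε) ≤ ((X i).card : ℝ) ^ 2 * ((Y i).card : ℝ) ^ 2 := by
          rw [← mul_pow]
          calc (p : ℝ) ^ (3 + 2 * ε) = ((p : ℝ) ^ (3 / 2 + ε)) ^ 2 := by
                rw [← Real.rpow_natCast, ← Real.rpow_mul hp.le]; congr 1; push_cast; ring
            _ ≤ _ := by gcongr; exact hmem i (hKI hi)
        have h5 : (p : ℝ) ^ (3 + 2 * ε) = (p : ℝ) ^ 2 * ((p : ℝ) ^ (1 + ε) * (p : ℝ) ^ ε) := by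
          rw [← Real.rpow_add hp, ← Real.rpow_natCast, ← Real.rpow_add hp]
          congr 1; push_cast; ring
        have h6 : (p : ℝ) ^ 2 * ((p : ℝ) ^ (1 + ε) * 4)
            ≤ (p : ℝ) ^ 2 * ((p : ℝ) ^ (1 + ε) * (p : ℝ) ^ ε) := by gcongr
        have h7 : (4 * (p : ℝ) ^ 2) * (p : ℝ) ^ (1 + ε) ≤ (4 * (p : ℝ) ^ 2) *
            ((sumFiber (X i) (q i).1).card * (sumFiber (Y i) (q i).2).card) := by
          linarith
        exact le_of_mul_le_mul_left h7 (by positivity)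
      · rw [hKk, ← div_le_iff₀ hε]
        exact Nat.le_ceil _
  · obtain ⟨hk, hkI⟩ := hm₂ I.card ((le_max_right _ _).trans hIm)
    refine exists_finset_coversFiber I (fun i => repeatedSums (X i)) (fun i => repeatedSums (Y i))
      (by positivity) hX2 hY2 (fun i _ => repeatedSums_eq_univ) (fun i _ => repeatedSums_eq_univ)
      (fun i hi => ?_) hk hkI (fun K hKI hKk q hq s => ?_)
    · have hle : ∀ S : Finset (ZMod p), (S.card : ℝ) ≤ P := fun S => by
        exact_mod_cast (card_finset_le S).trans (not_le.1 hpP).le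
      have h1 : (1 : ℝ) ≤ (repeatedSums (X i)).card := by
        exact_mod_cast (repeatedSums_nonempty (hX2 i hi)).card_pos
      have h2 : (1 : ℝ) ≤ (repeatedSums (Y i)).card := by
        exact_mod_cast (repeatedSums_nonempty (hY2 i hi)).card_pos
      calc ((X i).card * (Y i).card : ℝ) ≤ P * P :=
            mul_le_mul (hle _) (hle _) (by positivity) hPpos.le
        _ = (P : ℝ) ^ 2 * (1 * 1) := by ring
        _ ≤ _ := by gcongr
    -- Here |K| = P > p, and a fibre with two elements has a nonzero one.
    · refine exists_sum_mul_add_eq_of_two_le_card K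
        (fun i => sumFiber (X i) (q i).1) (fun i => sumFiber (Y i) (q i).2)
        (fun i => c (q i).2) (fun i hi => (Finset.mem_filter.1 (hq i hi).1).2)
        (fun i hi => Finset.exists_mem_ne (Finset.mem_filter.1 (hq i hi).2).2 0) (by omega) s

end Covering

/-! ### From covered fibres to cosets of the center. -/

section Groups

variable {n p : ℕ} [Fact p.Prime] {G : Type*} [Group G]

/-- The group structure of `G` is, in the coordinates `e`, that of the central extension of
`𝔽_p ^ n × 𝔽_p ^ n` by `𝔽_p` with the cocycle `⟨x, y'⟩ + ∑ i, κ (y i) (y' i)`. -/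
structure IsHeisenbergLike (e : G ≃ (Fin n → ZMod p) × (Fin n → ZMod p) × ZMod p)
    (κ : ZMod p → ZMod p → ZMod p) : Prop where
  symm : ∀ a b, κ a b = κ b a
  mul_x : ∀ g h, (e (g * h)).1 = (e g).1 + (e h).1
  mul_y : ∀ g h, (e (g * h)).2.1 = (e g).2.1 + (e h).2.1
  mul_z : ∀ g h, (e (g * h)).2.2 = (e g).2.2 + (e h).2.2 +
    ∑ i, ((e g).1 i * (e h).2.1 i + κ ((e g).2.1 i) ((e h).2.1 i))

namespace IsHeisenbergLike

variable {e : G ≃ (Fin n → ZMod p) × (Fin n → ZMod p) × ZMod p} {κ : ZMod p → ZMod p → ZMod p}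

/-- The symmetric κ cancels from the commutation relation, leaving a nondegenerate pairing that is
tested on unit vectors. -/
theorem mem_center_iff (he : IsHeisenbergLike e κ) (g : G) :
    g ∈ Subgroup.center G ↔ (e g).1 = 0 ∧ (e g).2.1 = 0 := by
  have hcomm : ∀ h, h * g = g * h ↔
      ∑ i, (e h).1 i * (e g).2.1 i = ∑ i, (e g).1 i * (e h).2.1 i := by
    intro h
    have hs : ∑ i, κ ((e h).2.1 i) ((e g).2.1 i) = ∑ i, κ ((e g).2.1 i) ((e h).2.1 i) :=
      Finset.sum_congr rfl fun i _ => he.symm _ _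
    rw [← e.injective.eq_iff, Prod.ext_iff, Prod.ext_iff, he.mul_x, he.mul_x, he.mul_y, he.mul_y,
      he.mul_z, he.mul_z, Finset.sum_add_distrib, Finset.sum_add_distrib, hs]
    constructor
    · rintro ⟨-, -, h3⟩
      linear_combination h3
    · intro h3
      exact ⟨add_comm _ _, add_comm _ _, by linear_combination h3⟩
  rw [Subgroup.mem_center_iff]
  constructor
  · intro h
    refine ⟨funext fun i => ?_, funext fun i => ?_⟩
    · have := (hcomm _).1 (h (e.symm (0, Pi.single i 1, 0)))
      simpa [Pi.single_apply] using this.symm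
    · have := (hcomm _).1 (h (e.symm (Pi.single i 1, 0, 0)))
      simpa [Pi.single_apply] using this
  · rintro ⟨h1, h2⟩ h
    rw [hcomm, h1, h2]
    simp

theorem center_ne_bot (he : IsHeisenbergLike e κ) : Subgroup.center G ≠ ⊥ := by
  intro h
  have h1 : ∀ z, e.symm (0, 0, z) = 1 := fun z => by
    rw [← Subgroup.mem_bot, ← h, he.mem_center_iff]; simp
  have h2 := e.symm.injective ((h1 0).trans (h1 1).symm)
  simp at h2

theorem smul_center_eq (he : IsHeisenbergLike e κ) (g : G) :
    g • (Subgroup.center G : Set G) = {h | (e h).1 = (e g).1 ∧ (e h).2.1 = (e g).2.1} := by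
  ext h
  rw [Set.mem_smul_set_iff_inv_smul_mem, smul_eq_mul, SetLike.mem_coe, he.mem_center_iff]
  have hx := he.mul_x g (g⁻¹ * h)
  have hy := he.mul_y g (g⁻¹ * h)
  rw [mul_inv_cancel_left] at hx hy
  simp [hx, hy]

theorem card_div_le_ncard_cosetsIn (he : IsHeisenbergLike e κ) {X Y : Fin n → Set (ZMod p)}
    {Z : Set (ZMod p)} (hZ : Z.Nonempty) {B : Set G}
    (hB : B = {g | (∀ i, (e g).1 i ∈ X i) ∧ (∀ i, (e g).2.1 i ∈ Y i) ∧ (e g).2.2 ∈ Z}) {ε : ℝ}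
    (hcov : ∀ (X Y : Fin n → Finset (ZMod p)) (c : ZMod p → ZMod p → ZMod p),
      (p : ℝ) ^ ((2 * n + 1) * (3 / 4 + ε)) < p * ∏ i, ((X i).card * (Y i).card : ℝ) →
      ∃ W : Finset (Fin n → ZMod p × ZMod p),
        ∏ i, (X i).card * (Y i).card ≤ W.card ∧ ∀ q ∈ W, CoversFiber X Y c q)
    (hcard : (Nat.card G : ℝ) ^ (3 / 4 + ε) < (B.ncard : ℝ)) :
    (B.ncard : ℝ) / (p : ℝ) ≤ ((cosetsIn (Subgroup.center G) (B * B)).ncard : ℝ) := by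
  classical
  have hp : (0 : ℝ) < p := by exact_mod_cast (Fact.out : p.Prime).pos
  have : Finite G := Finite.of_equiv _ e.symm
  have hG : Nat.card G = p ^ (2 * n + 1) := by
    rw [Nat.card_congr e]
    simp [Nat.card_eq_fintype_card, ZMod.card]
    ring
  set X' : Fin n → Finset (ZMod p) := fun i => (X i).toFinset with hX'
  set Y' : Fin n → Finset (ZMod p) := fun i => (Y i).toFinset with hY'
  have hBc : B.ncard = (∏ i, (X' i).card * (Y' i).card) * Z.ncard := by
    have h1 : B = e ⁻¹' ((Fintype.piFinset X' ×ˢ Fintype.piFinset Y' ×ˢ Z.toFinset :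
        Finset _) : Set _) := by
      ext g; simp [hB, hX', hY']
    rw [h1, Set.ncard_preimage_of_injective_subset_range e.injective (by simp),
      Set.ncard_coe_finset]
    simp only [Finset.card_product, Fintype.card_piFinset, Finset.prod_mul_distrib,
      Set.ncard_eq_toFinset_card']
    ring
  have hZp : Z.ncard ≤ p := by
    rw [Set.ncard_eq_toFinset_card']; exact card_finset_le _
  have hBp : (B.ncard : ℝ) ≤ p * ∏ i, ((X' i).card * (Y' i).card : ℝ) := by
    have h1 : B.ncard ≤ p * ∏ i, (X' i).card * (Y' i).card := by
      rw [hBc, mul_comm]; gcongr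
    exact_mod_cast h1
  -- The left factor has y-coordinate v - b when the right one has b, whence the shift κ(v - b, b).
  obtain ⟨W, hW, hWc⟩ := hcov X' Y' (fun v b => κ (v - b) b) (by
    refine lt_of_eq_of_lt ?_ (hcard.trans_le hBp)
    rw [hG, Real.rpow_mul hp.le]
    congr 1
    push_cast
    rw [← Real.rpow_natCast]
    push_cast
    rfl)
  let F : (Fin n → ZMod p × ZMod p) → Set G := fun q =>
    {h | (e h).1 = (fun i => (q i).1) ∧ (e h).2.1 = fun i => (q i).2}
  have hF : Function.Injective F := by
    intro q q' h
    have h1 : e.symm (fun i => (q i).1, fun i => (q i).2, 0) ∈ F q := by simp [F]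
    rw [h] at h1
    simp only [F, Set.mem_ofPred_eq, Equiv.apply_symm_apply] at h1
    exact funext fun i => Prod.ext (congrFun h1.1 i) (congrFun h1.2 i)
  obtain ⟨z, hz⟩ := hZ
  have hsub : F '' (W : Set (Fin n → ZMod p × ZMod p)) ⊆
      cosetsIn (Subgroup.center G) (B * B) := by
    rintro _ ⟨q, hq, rfl⟩
    refine ⟨⟨e.symm (fun i => (q i).1, fun i => (q i).2, 0), ?_⟩, ?_⟩
    · rw [he.smul_center_eq]; simp [F]
    · rintro h ⟨h1, h2⟩
      -- Both factors use the same `z`, which contributes 2z to the central coordinate.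
      obtain ⟨x, y, hxy, hs⟩ := hWc q (Finset.mem_coe.1 hq) ((e h).2.2 - 2 * z)
      simp only [mem_sumFiber, hX', hY', Set.mem_toFinset] at hxy
      refine Set.mem_mul.2 ⟨e.symm (x, fun i => (q i).2 - y i, z), ?_,
        e.symm (fun i => (q i).1 - x i, y, z), ?_, e.injective ?_⟩
      · simp only [hB, Set.mem_ofPred_eq, Equiv.apply_symm_apply]
        exact ⟨fun i => (hxy i).1.1, fun i => (hxy i).2.2, hz⟩
      · simp only [hB, Set.mem_ofPred_eq, Equiv.apply_symm_apply]
        exact ⟨fun i => (hxy i).1.2, fun i => (hxy i).2.1, hz⟩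
      · refine Prod.ext ?_ (Prod.ext ?_ ?_)
        · rw [he.mul_x, h1]; ext i; simp
        · rw [he.mul_y, h2]; ext i; simp
        · rw [he.mul_z]
          simp only [Equiv.apply_symm_apply]
          rw [hs]
          ring
  have hcount : W.card ≤ (cosetsIn (Subgroup.center G) (B * B)).ncard := by
    rw [← Set.ncard_coe_finset W, ← Set.ncard_image_of_injective _ hF]
    exact Set.ncard_le_ncard hsub (Set.toFinite _)
  rw [div_le_iff₀ hp]
  refine hBp.trans ?_
  rw [mul_comm]
  gcongr
  exact_mod_cast hW.trans hcount

end IsHeisenbergLike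

end Groups

/-! ### The two families H_n and M_n, and the conclusion. -/

/-- The coordinates of an element of `H_n`. -/
def HeisGroup.coords (n p : ℕ) :
    HeisGroup n p ≃ (Fin n → ZMod p) × (Fin n → ZMod p) × ZMod p where
  toFun g := (g.x, g.y, g.z)
  invFun q := ⟨q.1, q.2.1, q.2.2⟩
  left_inv _ := rfl
  right_inv _ := rfl

/-- The coordinates of an element of `M_n`. -/
def ModGroup.coords (n p : ℕ) :
    ModGroup n p ≃ (Fin n → ZMod p) × (Fin n → ZMod p) × ZMod p where
  toFun g := (g.x, g.y, g.z)
  invFun q := ⟨q.1, q.2.1, q.2.2⟩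
  left_inv _ := rfl
  right_inv _ := rfl

theorem HeisGroup.isHeisenbergLike_coords (n p : ℕ) [Fact p.Prime] :
    IsHeisenbergLike (HeisGroup.coords n p) fun _ _ => 0 where
  symm _ _ := rfl
  mul_x _ _ := rfl
  mul_y _ _ := rfl
  mul_z g h := by simp [HeisGroup.coords]

theorem ModGroup.isHeisenbergLike_coords (n p : ℕ) [Fact p.Prime] :
    IsHeisenbergLike (ModGroup.coords n p) fun a b => (((a.val + b.val) / p : ℕ) : ZMod p) where
  symm a b := by rw [add_comm]
  mul_x _ _ := rfl
  mul_y _ _ := rfl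
  mul_z g h := by
    simp [ModGroup.coords, ModGroup.carry, Finset.sum_add_distrib, add_assoc]

theorem theorem3 (ε : ℝ) (hε : 0 < ε) :
    ∃ n₀ : ℕ, 0 < n₀ ∧ ∀ n : ℕ, n₀ ≤ n → ∀ (p : ℕ) [Fact p.Prime],
      (∀ B : Set (HeisGroup n p), HeisGroup.IsBrick B →
        (Nat.card (HeisGroup n p) : ℝ) ^ (3 / 4 + ε) < (B.ncard : ℝ) →
        Subgroup.center (HeisGroup n p) ≠ ⊥ ∧
        (B.ncard : ℝ) / (p : ℝ) ≤
          ((cosetsIn (Subgroup.center (HeisGroup n p)) (B * B)).ncard : ℝ)) ∧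
      (∀ B : Set (ModGroup n p), ModGroup.IsBrick B →
        (Nat.card (ModGroup n p) : ℝ) ^ (3 / 4 + ε) < (B.ncard : ℝ) →
        Subgroup.center (ModGroup n p) ≠ ⊥ ∧
        (B.ncard : ℝ) / (p : ℝ) ≤
          ((cosetsIn (Subgroup.center (ModGroup n p)) (B * B)).ncard : ℝ)) := by
  obtain ⟨n₀, hn₀, h⟩ := exists_forall_exists_finset_coversFiber hε
  refine ⟨n₀, hn₀, fun n hn p _ => ⟨fun B hB hcard => ?_, fun B hB hcard => ?_⟩⟩
  · obtain ⟨X, Y, Z, -, -, hZ, hBe⟩ := hB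
    have he := HeisGroup.isHeisenbergLike_coords n p
    exact ⟨he.center_ne_bot, he.card_div_le_ncard_cosetsIn hZ hBe (h n hn p) hcard⟩
  · obtain ⟨X, Y, Z, -, -, hZ, hBe⟩ := hB
    have he := ModGroup.isHeisenbergLike_coords n p
    exact ⟨he.center_ne_bot, he.card_div_le_ncard_cosetsIn hZ hBe (h n hn p) hcard⟩
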